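/- Consider coded caching with $K\ge 1$ receivers and a library of $N\ge 1$ messages $W=(W_1,\dots,W_N)$, each taking values in $\{1,\dots,2^F\}$. For $M\ge 0$, a scheme with message length $F$ and delivery rates $(R_{\mathbf d})_{\mathbf d\in\{1,\dots,N\}^K}$ consists of caching functions $g_k:\{1,\dots,2^F\}^N\to\{1,\dots,\lfloor 2^{FM}\rfloor\}$, $k=1,\dots,K$ (not depending on the demand vector), and, for every demand vector $\mathbf d=(d_1,\dots,d_K)\in\{1,\dots,N\}^K$, an encoding function $f_{\mathbf d}:\{1,\dots,2^F\}^N\to\{1,\dots,\lfloor 2^{FR_{\mathbf d}}\rfloor\}$ and decoding functions $\varphi_{k,\mathbf d}:\{1,\dots,\lfloor 2^{FR_{\mathbf d}}\rfloor\}\times\{1,\dots,\lfloor 2^{FM}\rfloor\}\to\{1,\dots,2^F\}$, such that $\varphi_{k,\mathbf d}(f_{\mathbf d}(W),g_k(W))=W_{d_k}$ for all $k$, $\mathbf d$ and $W$. The pair $(R,M)$ is achievable (in the average-case scenario) if for every $\epsilon>0$ and all sufficiently large $F$ there is such a scheme with $\frac{1}{N^K}\sum_{\mathbf d}R_{\mathbf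 d}\le R+\epsilon$. Let $R^\star_{\mathrm{avg}}(M)$ be the infimum of all $R$ such that $(R,M)$ is achievable, and let $$R^{\mathrm{low}}_{\mathrm{avg}}(M):=\max\left\{\max_{1\le\ell\le K}\left[\left(1-\left(1-\tfrac1N\right)^{\ell}\right)(N-\ell M)\right],\ \max_{1\le\ell\le K}\left[\left(1-\left(1-\tfrac1N\right)^{\ell}\right)N-\frac{\ell(\ell+1)}{2N}M\right]\right\}.$$ For $u\in(0,1]$ and $v\in(0,1/2]$ put $$\eta(u,v):=\frac{\left(u+v-v(1-v)^{u/v}\right)\left(1-\left(1-\frac{v}{u+v}(1-v)^{u/v}\right)^{1/v}\right)}{(1-v)^{u/v}\left(1-\left(1+\frac u2\right)(1-v)^{u/v}\right)}.$$ **Theorem.** The function $\eta$ is bounded above on $(0,1]\times(0,1/2]$, and for all integers $K,N\ge1$ and all real $M\in[0,N)$ the infimum $R^\star_{\mathrm{avg}}(M)$ is finite, $R^{\mathrm{low}}_{\mathrm{avg}}(M)>0$, and $$\frac{R^\star_{\mathrm{avg}}(M)}{R^{\mathrm{low}}_{\mathrm{avg}}(M)}\ \le\ \sup_{u\in(0,1],\,v\in(0,1/2]}\eta(u,v).$$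 -/

import Mathlib

open Filter Set

namespace CodedCaching

/-- A realization of the library: `N` messages, each one of `2 ^ F` possible values. -/
abbrev Library (N F : ℕ) : Type := Fin N → Fin (2 ^ F)

/-- A demand vector: receiver `k` demands the message with index `d k`. -/
abbrev Demand (K N : ℕ) : Type := Fin K → Fin N

/-- A zero-error coded caching scheme for `K` receivers and `N` messages of `F` bits, with cache
memories of `F * M` bits and with delivery rate `Rd d` for the demand vector `d`. The caching
functions do not depend on the demand vector; encoding and decoding functions do. -/
structure Scheme (K N F : ℕ) (M : ℝ) (Rd : Demand K N → ℝ) where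
  /-- the caching functions `g_k` -/
  cache : Fin K → Library N F → Fin ⌊(2 : ℝ) ^ ((F : ℝ) * M)⌋₊
  /-- the encoding functions `f_d` -/
  encode : (d : Demand K N) → Library N F → Fin ⌊(2 : ℝ) ^ ((F : ℝ) * Rd d)⌋₊
  /-- the decoding functions `φ_{k,d}` -/
  decode : Fin K → (d : Demand K N) → Fin ⌊(2 : ℝ) ^ ((F : ℝ) * Rd d)⌋₊ →
    Fin ⌊(2 : ℝ) ^ ((F : ℝ) * M)⌋₊ → Fin (2 ^ F)
  /-- every receiver recovers its demanded message, for every demand and every library -/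
  correct : ∀ (d : Demand K N) (W : Library N F) (k : Fin K),
    decode k d (encode d W) (cache k W) = W (d k)

/-- The rate-memory pair `(R, M)` is achievable in the average-case scenario. -/
def AvgAchievable (K N : ℕ) (M R : ℝ) : Prop :=
  ∀ ε : ℝ, 0 < ε → ∀ᶠ F : ℕ in atTop, ∃ Rd : Demand K N → ℝ,
    Nonempty (Scheme K N F M Rd) ∧ (1 / (N : ℝ) ^ K) * ∑ d : Demand K N, Rd d ≤ R + ε

/-- The average-case rate-memory tradeoff `R*_avg(M)`. -/
noncomputable def avgTradeoff (K N : ℕ) (M : ℝ) : ℝ :=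
  sInf {R : ℝ | AvgAchievable K N M R}

/-- The lower bound `R^low_avg(M)`: both inner maxima range over `ℓ ∈ {1, …, K}`. -/
noncomputable def avgLow (K N : ℕ) (hK : 1 ≤ K) (M : ℝ) : ℝ :=
  max
    ((Finset.Icc 1 K).sup' (Finset.nonempty_Icc.mpr hK) fun ℓ : ℕ =>
      (1 - (1 - 1 / (N : ℝ)) ^ ℓ) * ((N : ℝ) - (ℓ : ℝ) * M))
    ((Finset.Icc 1 K).sup' (Finset.nonempty_Icc.mpr hK) fun ℓ : ℕ =>
      (1 - (1 - 1 / (N : ℝ)) ^ ℓ) * (N : ℝ) - ((ℓ : ℝ) * ((ℓ : ℝ) + 1)) / (2 * (N : ℝ)) * M)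

/-- The explicit function `η(u, v)` bounding the gap. -/
noncomputable def eta (u v : ℝ) : ℝ :=
  ((u + v - v * (1 - v) ^ (u / v)) *
      (1 - (1 - v / (u + v) * (1 - v) ^ (u / v)) ^ (1 / v))) /
    ((1 - v) ^ (u / v) * (1 - (1 + u / 2) * (1 - v) ^ (u / v)))

/-- The set of values `η(u, v)` for `u ∈ (0, 1]` and `v ∈ (0, 1/2]`. -/
def etaValues : Set ℝ :=
  {y : ℝ | ∃ u ∈ Ioc (0 : ℝ) 1, ∃ v ∈ Ioc (0 : ℝ) (1 / 2), y = eta u v}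

end CodedCaching

/-! Only an upper bound on the tradeoff is needed: `avgLow` is never shown to bound rates from
below, and only its second maximum is used. One placement serves all demands at a common rate.

Placement: let each receiver cache each symbol independently with probability `q`, with the subset
frequencies realised deterministically up to rounding (`avgAchievable_of_weights`). Delivery: choose
one leader per demanded message and multicast only to groups containing a leader; a linear relation
in characteristic two supplies the other multicasts (`sum_multicast_transversals`). For `0 < q`, at
most `N` leaders give rate at most `(1 - q) / q * (1 - (1 - q) ^ N)`.

Comparison: the lines `lowLine N ℓ` and `lowLine N (ℓ + 1)` meet at `M = N * corner N ℓ`. With `q =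
corner N ℓ`, the ratio of the rate bound to the line there is exactly `eta (ℓ / N) (1 / N)`
(`bernoulliRate_corner_le`). The endpoints `q = 1` and `q = 0` are treated directly. Between
consecutive nodes, the memory-sharing rate and the line are both affine in `M`, so the comparison at
the nodes carries over. Finally `eta` is bounded because its denominator is at least, and its
numerator at most, a constant times `u`. -/

namespace CodedCaching

/-! ### Multicast delivery and leaders in characteristic two -/

section Multicast

variable {ι κ V : Type*} [DecidableEq ι] [DecidableEq κ] [AddCommGroup V]

/-- The coded multicast message for the group `A` of receivers: receiver `k` misses the part
indexed by `A.erase k` of its demanded message. -/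
def multicast (d : ι → κ) (z : κ → Finset ι → V) (A : Finset ι) : V :=
  ∑ k ∈ A, z (d k) (A.erase k)

/-- The subsets of `B` containing exactly one receiver for each demand occurring in `B`. -/
def transversals (d : ι → κ) (B : Finset ι) : Finset (Finset ι) :=
  B.powerset.filter fun T => ∀ k ∈ B, ∃ j ∈ T, d j = d k ∧ ∀ i ∈ T, d i = d k → i = j

/-- Exchanging a receiver `k` outside `T` with the member of `T` having the same demand gives
another transversal and leaves both the demanded message and the set `(B \ T).erase k` unchanged.
This fixed-point-free involution pairs equal terms, which cancel. -/
theorem sum_multicast_transversals (hV : ∀ x : V, x + x = 0) (d : ι → κ) (z : κ → Finset ι → V)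
    (B : Finset ι) : ∑ T ∈ transversals d B, multicast d z (B \ T) = 0 := by
  have hrep : ∀ (T : Finset ι) (k : ι), ∃ j, T ∈ transversals d B → k ∈ B →
      j ∈ T ∧ d j = d k ∧ ∀ i ∈ T, d i = d k → i = j := by
    intro T k
    by_cases h : T ∈ transversals d B ∧ k ∈ B
    · obtain ⟨j, hj⟩ := (Finset.mem_filter.mp h.1).2 k h.2
      exact ⟨j, fun _ _ => hj⟩
    · exact ⟨k, fun h1 h2 => absurd ⟨h1, h2⟩ h⟩
  choose rep hrep using hrep
  have hsub : ∀ T ∈ transversals d B, T ⊆ B := fun T hT =>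
    Finset.mem_powerset.mp (Finset.mem_filter.mp hT).1
  have hswap : ∀ T ∈ transversals d B, ∀ k ∈ B, k ∉ T →
      insert k (T.erase (rep T k)) ∈ transversals d B := by
    intro T hT k hk hkT
    obtain ⟨hj1, hj2, hj3⟩ := hrep T k hT hk
    refine Finset.mem_filter.mpr ⟨Finset.mem_powerset.mpr ?_, ?_⟩
    · exact Finset.insert_subset hk ((Finset.erase_subset _ _).trans (hsub T hT))
    · intro m hm
      by_cases hmk : d m = d k
      · refine ⟨k, Finset.mem_insert_self _ _, hmk.symm, fun i hi hdi => ?_⟩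
        rcases Finset.mem_insert.mp hi with rfl | hi
        · rfl
        · obtain ⟨h1, h2⟩ := Finset.mem_erase.mp hi
          exact absurd (hj3 i h2 (hdi.trans hmk)) h1
      · obtain ⟨h1, h2, h3⟩ := hrep T m hT hm
        refine ⟨rep T m, Finset.mem_insert_of_mem (Finset.mem_erase.mpr ⟨fun h => ?_, h1⟩), h2,
          fun i hi hdi => ?_⟩
        · exact hmk (by rw [← h2, h, hj2])
        · rcases Finset.mem_insert.mp hi with rfl | hi
          · exact absurd hdi.symm hmk
          · exact h3 i (Finset.mem_of_mem_erase hi) hdi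
  have hback : ∀ T ∈ transversals d B, ∀ k ∈ B, k ∉ T →
      rep (insert k (T.erase (rep T k))) (rep T k) = k := by
    intro T hT k hk hkT
    obtain ⟨hj1, hj2, -⟩ := hrep T k hT hk
    exact ((hrep _ (rep T k) (hswap T hT k hk hkT) (hsub T hT hj1)).2.2 k
      (Finset.mem_insert_self _ _) hj2.symm).symm
  unfold multicast
  rw [Finset.sum_sigma']
  refine Finset.sum_involution
    (fun p _ => ⟨insert p.2 (p.1.erase (rep p.1 p.2)), rep p.1 p.2⟩) ?_ ?_ ?_ ?_
  · rintro ⟨T, k⟩ hp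
    obtain ⟨hT, hk⟩ := Finset.mem_sigma.mp hp
    obtain ⟨hk, hkT⟩ := Finset.mem_sdiff.mp hk
    obtain ⟨hj1, hj2, -⟩ := hrep T k hT hk
    have : (B \ insert k (T.erase (rep T k))).erase (rep T k) = (B \ T).erase k := by
      ext i
      simp only [Finset.mem_erase, Finset.mem_sdiff, Finset.mem_insert, not_or, not_and]
      constructor
      · rintro ⟨h1, h2, h3, h4⟩
        exact ⟨h3, h2, fun h => h1 (by_contra fun h' => (h4 h') h)⟩
      · rintro ⟨h1, h2, h3⟩
        exact ⟨fun h => h3 (h ▸ hj1), h2, h1, fun _ h => h3 h⟩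
    simp only
    rw [this, hj2, hV]
  · rintro ⟨T, k⟩ hp _ heq
    obtain ⟨hT, hk⟩ := Finset.mem_sigma.mp hp
    obtain ⟨hk, hkT⟩ := Finset.mem_sdiff.mp hk
    have h2 : rep T k = k := congrArg Sigma.snd heq
    exact hkT (h2 ▸ (hrep T k hT hk).1)
  · rintro ⟨T, k⟩ hp
    obtain ⟨hT, hk⟩ := Finset.mem_sigma.mp hp
    obtain ⟨hk, hkT⟩ := Finset.mem_sdiff.mp hk
    have hj1 := (hrep T k hT hk).1
    have hjk : rep T k ≠ k := fun h => hkT (h ▸ hj1)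
    refine Finset.mem_sigma.mpr ⟨hswap T hT k hk hkT, Finset.mem_sdiff.mpr ⟨hsub T hT hj1, ?_⟩⟩
    simp [hjk]
  · rintro ⟨T, k⟩ hp
    obtain ⟨hT, hk⟩ := Finset.mem_sigma.mp hp
    obtain ⟨hk, hkT⟩ := Finset.mem_sdiff.mp hk
    have hj1 := (hrep T k hT hk).1
    simp only
    rw [hback T hT k hk hkT, Finset.erase_insert (fun h => hkT (Finset.mem_of_mem_erase h)),
      Finset.insert_erase hj1]

/-- A set of leaders: one receiver for each demanded message. -/
def IsLeaderSet (d : ι → κ) (U : Finset ι) : Prop :=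
  ∀ k, ∃ j ∈ U, d j = d k ∧ ∀ i ∈ U, d i = d k → i = j

omit [DecidableEq ι] [DecidableEq κ] in
theorem exists_isLeaderSet [Fintype ι] (d : ι → κ) : ∃ U : Finset ι, IsLeaderSet d U := by
  obtain ⟨s, -, hs⟩ := Set.SurjOn.exists_bijOn_subset (Set.surjOn_image d Set.univ)
  refine ⟨s.toFinite.toFinset, fun k => ?_⟩
  obtain ⟨j, hj, hjk⟩ := hs.surjOn ⟨k, trivial, rfl⟩
  refine ⟨j, by simpa using hj, hjk, fun i hi hik => ?_⟩
  exact hs.injOn (by simpa using hi) hj (hik.trans hjk.symm)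

omit [DecidableEq ι] [DecidableEq κ] in
theorem IsLeaderSet.injOn {d : ι → κ} {U : Finset ι} (hU : IsLeaderSet d U) :
    Set.InjOn d U := by
  intro i hi j hj hij
  obtain ⟨m, -, -, h⟩ := hU j
  exact (h i hi hij).trans (h j hj rfl).symm

/-- The multicast messages for groups without a leader are determined by the other ones. -/
theorem multicast_eq_zero_of_leaders (hV : ∀ x : V, x + x = 0) {d : ι → κ} {U : Finset ι}
    (hU : IsLeaderSet d U) {z : κ → Finset ι → V}
    (hz : ∀ A : Finset ι, (A ∩ U).Nonempty → multicast d z A = 0) (A : Finset ι) :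
    multicast d z A = 0 := by
  by_cases hA : (A ∩ U).Nonempty
  · exact hz A hA
  have hdisj : Disjoint A U :=
    Finset.disjoint_iff_inter_eq_empty.mpr (Finset.not_nonempty_iff_eq_empty.mp hA)
  -- A transversal of `A ∪ U` other than `U` omits some leader, so its complement contains one; only
  -- the term of `A` survives.
  have hsum := sum_multicast_transversals hV d z (A ∪ U)
  have hUmem : U ∈ transversals d (A ∪ U) :=
    Finset.mem_filter.mpr ⟨Finset.mem_powerset.mpr Finset.subset_union_right, fun k _ => hU k⟩
  rw [Finset.sum_eq_single_of_mem U hUmem, Finset.union_sdiff_cancel_right hdisj] at hsum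
  · exact hsum
  · intro T hT hTU
    apply hz
    by_contra hne
    obtain ⟨hTB, hTd⟩ := Finset.mem_filter.mp hT
    have hUT : U ⊆ T := by
      intro i hi
      by_contra hiT
      exact hne ⟨i, by simp [hi, hiT]⟩
    refine hTU (Finset.Subset.antisymm (fun i hi => ?_) hUT)
    obtain ⟨j, hj, -, huniq⟩ := hTd i (Finset.mem_powerset.mp hTB hi)
    obtain ⟨m, hm, hmi, -⟩ := hU i
    rw [huniq i hi rfl, ← huniq m (hUT hm) hmi]
    exact hm

/-- A receiver recovers all parts of its demanded message from its cache and the multicast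
messages of the groups containing a leader. -/
theorem part_eq_zero_of_multicast (hV : ∀ x : V, x + x = 0) {d : ι → κ} {U : Finset ι}
    (hU : IsLeaderSet d U) {z : κ → Finset ι → V}
    (hz : ∀ A : Finset ι, (A ∩ U).Nonempty → multicast d z A = 0) (k : ι)
    (hk : ∀ n S, k ∈ S → z n S = 0) (S : Finset ι) : z (d k) S = 0 := by
  by_cases hkS : k ∈ S
  · exact hk _ _ hkS
  -- In the group `insert k S`, every summand except that of `k` is a part cached at `k`.
  have h := multicast_eq_zero_of_leaders hV hU hz (insert k S)
  rw [multicast, Finset.sum_insert hkS, Finset.erase_insert hkS, Finset.sum_eq_zero,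
    add_zero] at h
  · exact h
  · intro j hj
    exact hk _ _ (Finset.mem_erase.mpr ⟨fun h => hkS (h ▸ hj), Finset.mem_insert_self _ _⟩)

end Multicast

/-! ### From symmetric placements to schemes -/

/-- The decoder may answer with any library consistent with what it sees, since all of them agree on
the demanded message. -/
theorem nonempty_scheme_of_determined {K N F : ℕ} {M : ℝ} {Rd : Demand K N → ℝ}
    {C : Fin K → Type} [∀ k, Fintype (C k)] {E : Demand K N → Type} [∀ d, Fintype (E d)]
    (hC : ∀ k, Fintype.card (C k) ≤ ⌊(2 : ℝ) ^ ((F : ℝ) * M)⌋₊)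
    (hE : ∀ d, Fintype.card (E d) ≤ ⌊(2 : ℝ) ^ ((F : ℝ) * Rd d)⌋₊)
    (g : ∀ k, Library N F → C k) (f : ∀ d, Library N F → E d)
    (h : ∀ d k W W', f d W = f d W' → g k W = g k W' → W (d k) = W' (d k)) :
    Nonempty (Scheme K N F M Rd) := by
  classical
  have hc : ∀ k, Nonempty (C k ↪ Fin ⌊(2 : ℝ) ^ ((F : ℝ) * M)⌋₊) := fun k =>
    Function.Embedding.nonempty_of_card_le (by simpa using hC k)
  have he : ∀ d, Nonempty (E d ↪ Fin ⌊(2 : ℝ) ^ ((F : ℝ) * Rd d)⌋₊) := fun d =>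
    Function.Embedding.nonempty_of_card_le (by simpa using hE d)
  choose c hc' using fun k => (hc k).elim fun x => (⟨x, x.injective⟩ : ∃ φ : C k → _,
    Function.Injective φ)
  choose e he' using fun d => (he d).elim fun x => (⟨x, x.injective⟩ : ∃ φ : E d → _,
    Function.Injective φ)
  refine ⟨⟨fun k W => c k (g k W), fun d W => e d (f d W), fun k d y x =>
    if hW : ∃ W, e d (f d W) = y ∧ c k (g k W) = x then hW.choose (d k)
      else ⟨0, by positivity⟩, fun d W k => ?_⟩⟩
  have hW : ∃ W', e d (f d W') = e d (f d W) ∧ c k (g k W') = c k (g k W) := ⟨W, rfl, rfl⟩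
  simp only [dif_pos hW]
  exact h d k _ _ (he' d hW.choose_spec.1) (hc' k hW.choose_spec.2)

theorem two_pow_le_floor_rpow {b : ℕ} {x : ℝ} (h : (b : ℝ) ≤ x) :
    2 ^ b ≤ ⌊(2 : ℝ) ^ x⌋₊ := by
  apply Nat.le_floor
  push_cast
  rw [← Real.rpow_natCast]
  exact Real.rpow_le_rpow_of_exponent_le one_le_two h

/-- The symmetric placement storing a part of `n #S` bits of every message at the receivers in
`S`, with multicast delivery to the groups containing a leader. -/
theorem nonempty_scheme_of_placement {K N F : ℕ} {M : ℝ} {Rd : Demand K N → ℝ} (n : ℕ → ℕ)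
    (hn : ∑ S : Finset (Fin K), n S.card = F)
    (hM : ∀ k : Fin K,
      ((N * ∑ S : Finset (Fin K) with k ∈ S, n S.card : ℕ) : ℝ) ≤ F * M)
    (hR : ∀ d : Demand K N, ∃ U : Finset (Fin K), IsLeaderSet d U ∧
      ((∑ A : Finset (Fin K) with (A ∩ U).Nonempty, n (A.card - 1) : ℕ) : ℝ) ≤ F * Rd d) :
    Nonempty (Scheme K N F M Rd) := by
  classical
  choose U hU hUR using hR
  let Pos : Type := Σ S : Finset (Fin K), Fin (n S.card)
  have hcard : Fintype.card (Fin (2 ^ F)) = Fintype.card (Pos → ZMod 2) := by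
    simp [Pos, ZMod.card, hn]
  let e : Fin (2 ^ F) ≃ (Pos → ZMod 2) := Fintype.equivOfCardEq hcard
  -- Parts are padded by zeros to a common space so that they can be added; all parts in a multicast
  -- to `A` have length `n (A.card - 1)`.
  let z : Library N F → Fin N → Finset (Fin K) → ℕ → ZMod 2 := fun W m S i =>
    if h : i < n S.card then e (W m) ⟨S, ⟨i, h⟩⟩ else 0
  let C : Fin K → Type := fun k =>
    Fin N × (Σ S : {S : Finset (Fin K) // S ∈ Finset.univ.filter fun S => k ∈ S},
      Fin (n S.1.card)) → ZMod 2
  let E : Demand K N → Type := fun d =>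
    (Σ A : {A : Finset (Fin K) // A ∈ Finset.univ.filter fun A => (A ∩ U d).Nonempty},
      Fin (n (A.1.card - 1))) → ZMod 2
  have hC : ∀ k, Fintype.card (C k) =
      2 ^ (N * ∑ S : Finset (Fin K) with k ∈ S, n S.card) := by
    intro k
    simp only [C, Fintype.card_pi, ZMod.card, Finset.prod_const, Finset.card_univ,
      Fintype.card_prod, Fintype.card_fin, Fintype.card_sigma]
    rw [Finset.sum_coe_sort _ (fun S : Finset (Fin K) => n S.card)]
  have hE : ∀ d, Fintype.card (E d) =
      2 ^ (∑ A : Finset (Fin K) with (A ∩ U d).Nonempty, n (A.card - 1)) := by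
    intro d
    simp only [E, Fintype.card_pi, ZMod.card, Finset.prod_const, Finset.card_univ,
      Fintype.card_fin, Fintype.card_sigma]
    rw [Finset.sum_coe_sort _ (fun A : Finset (Fin K) => n (A.card - 1))]
  refine nonempty_scheme_of_determined (C := C) (E := E)
    (fun k => (hC k).trans_le (two_pow_le_floor_rpow (hM k)))
    (fun d => (hE d).trans_le (two_pow_le_floor_rpow (hUR d)))
    (fun k W p => z W p.1 p.2.1.1 p.2.2) (fun d W p => multicast d (z W) p.1.1 p.2) ?_
  intro d k W W' hf hg
  have hV : ∀ x : ℕ → ZMod 2, x + x = 0 := fun x => by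
    ext i; exact CharTwo.add_self_eq_zero (x i)
  have hlarge : ∀ (W : Library N F) m S i, ¬ i < n S.card → z W m S i = 0 :=
    fun W m S i h => dif_neg h
  -- By linearity, decoding reduces to a difference of two libraries whose transmitted and cached
  -- symbols vanish.
  have hzero := part_eq_zero_of_multicast hV (hU d) (z := fun m S => z W m S - z W' m S)
    (fun A hA => ?_) k (fun m S hS => ?_)
  · apply e.injective
    ext ⟨S, i⟩
    have := congrFun (hzero S) i
    simpa [z, sub_eq_zero] using this
  · have hdiff : multicast d (fun m S => z W m S - z W' m S) A =
        multicast d (z W) A - multicast d (z W') A := Finset.sum_sub_distrib _ _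
    rw [hdiff, sub_eq_zero]
    ext i
    by_cases hi : i < n (A.card - 1)
    · exact congrFun hf ⟨⟨A, by simpa using hA⟩, ⟨i, hi⟩⟩
    · have : ∀ W, multicast d (z W) A i = 0 := fun W => by
        rw [multicast, Finset.sum_apply]
        exact Finset.sum_eq_zero fun j hj => hlarge _ _ _ _
          (by rwa [Finset.card_erase_of_mem hj])
      rw [this, this]
  · rw [sub_eq_zero]
    ext i
    by_cases hi : i < n S.card
    · exact congrFun hg ⟨m, ⟨⟨S, by simpa using hS⟩, ⟨i, hi⟩⟩⟩
    · rw [hlarge _ _ _ _ hi, hlarge _ _ _ _ hi]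

/-- A symmetric fractional placement with weights `w #S` is asymptotically achievable. -/
theorem avgAchievable_of_weights {K N : ℕ} (hN : 1 ≤ N) {M R : ℝ} {w : ℕ → ℝ}
    (hw0 : ∀ t, 0 ≤ w t) (hw1 : ∑ S : Finset (Fin K), w S.card = 1)
    (hwM : ∀ k : Fin K, N * ∑ S : Finset (Fin K) with k ∈ S, w S.card ≤ M)
    (hwR : ∀ (d : Demand K N) (U : Finset (Fin K)), IsLeaderSet d U →
      ∑ A : Finset (Fin K) with (A ∩ U).Nonempty, w (A.card - 1) ≤ R) :
    AvgAchievable K N M R := by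
  intro ε hε
  -- Rounding costs at most `2 ^ K` bits in each of at most `2 ^ K` multicasts.
  filter_upwards [eventually_ge_atTop ⌈(2 ^ K * 2 ^ K : ℝ) / ε⌉₊] with F hF
  have hFε : (2 ^ K * 2 ^ K : ℝ) ≤ F * ε := by
    rw [← div_le_iff₀ hε]
    exact (Nat.le_ceil _).trans (by exact_mod_cast hF)
  refine ⟨fun _ => R + ε, ?_, ?_⟩
  swap
  · have : (N : ℝ) ^ K ≠ 0 := by positivity
    simp [← mul_add, inv_mul_cancel_left₀ this]
  set T : ℕ := ∑ S ∈ Finset.univ.erase (∅ : Finset (Fin K)), ⌊(F : ℝ) * w S.card⌋₊ with hT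
  -- The bits lost to rounding down stay uncached, so lengths sum to exactly `F` without using more
  -- memory.
  let n : ℕ → ℕ := fun t => if t = 0 then F - T else ⌊(F : ℝ) * w t⌋₊
  have hn0 : n 0 = F - T := rfl
  have hnpos : ∀ t, t ≠ 0 → n t = ⌊(F : ℝ) * w t⌋₊ := fun t ht => if_neg ht
  have hfl : ∀ t, (⌊(F : ℝ) * w t⌋₊ : ℝ) ≤ F * w t := fun t =>
    Nat.floor_le (mul_nonneg (Nat.cast_nonneg _) (hw0 t))
  have hsum : (F : ℝ) * w 0 + ∑ S ∈ Finset.univ.erase (∅ : Finset (Fin K)),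
      (F : ℝ) * w S.card = F := by
    have := Finset.add_sum_erase Finset.univ (fun S : Finset (Fin K) => (F : ℝ) * w S.card)
      (Finset.mem_univ ∅)
    rw [← Finset.mul_sum Finset.univ, hw1, mul_one] at this
    simpa using this
  have hTF : (T : ℝ) ≤ F := by
    rw [hT]
    push_cast
    have h0 : 0 ≤ (F : ℝ) * w 0 := mul_nonneg (Nat.cast_nonneg _) (hw0 0)
    have := Finset.sum_le_sum (s := Finset.univ.erase (∅ : Finset (Fin K)))
      (fun S _ => hfl S.card)
    linarith
  have hTF' : T ≤ F := by exact_mod_cast hTF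
  have hTlow : (F : ℝ) - F * w 0 - 2 ^ K ≤ T := by
    rw [hT]
    push_cast
    have h1 := Finset.sum_le_sum (s := Finset.univ.erase (∅ : Finset (Fin K)))
      (fun S _ => (Nat.sub_one_lt_floor ((F : ℝ) * w S.card)).le)
    rw [Finset.sum_sub_distrib] at h1
    have h2 : ∑ _S ∈ Finset.univ.erase (∅ : Finset (Fin K)), (1 : ℝ) ≤ 2 ^ K := by
      have := Finset.card_erase_le (s := (Finset.univ : Finset (Finset (Fin K)))) (a := ∅)
      simp only [Finset.card_univ, Fintype.card_finset, Fintype.card_fin] at this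
      rw [Finset.sum_const, nsmul_eq_mul, mul_one]
      exact_mod_cast this
    linarith
  have hnle : ∀ t, (n t : ℝ) ≤ F * w t + 2 ^ K := by
    intro t
    rcases eq_or_ne t 0 with rfl | ht
    · rw [hn0, Nat.cast_sub hTF']
      linarith
    · rw [hnpos t ht]
      have : (0 : ℝ) ≤ 2 ^ K := by positivity
      linarith [hfl t]
  refine nonempty_scheme_of_placement n ?_ (fun k => ?_) (fun d => ?_)
  · rw [← Finset.add_sum_erase _ _ (Finset.mem_univ ∅), Finset.card_empty, hn0,
      Finset.sum_congr rfl fun S hS => hnpos S.card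
        (Finset.card_ne_zero.mpr (Finset.nonempty_iff_ne_empty.mpr (Finset.ne_of_mem_erase hS))),
      ← hT, Nat.sub_add_cancel hTF']
  · push_cast
    calc (N : ℝ) * ∑ S : Finset (Fin K) with k ∈ S, (n S.card : ℝ)
        ≤ N * ∑ S : Finset (Fin K) with k ∈ S, F * w S.card := by
          gcongr with S hS
          rw [hnpos _ (Finset.card_ne_zero.mpr ⟨k, (Finset.mem_filter.mp hS).2⟩)]
          exact hfl _
      _ = F * (N * ∑ S : Finset (Fin K) with k ∈ S, w S.card) := by
          rw [← Finset.mul_sum]; ring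
      _ ≤ F * M := by gcongr; exact hwM k
  · obtain ⟨U, hU⟩ := exists_isLeaderSet d
    refine ⟨U, hU, ?_⟩
    push_cast
    calc ∑ A : Finset (Fin K) with (A ∩ U).Nonempty, (n (A.card - 1) : ℝ)
        ≤ ∑ A : Finset (Fin K) with (A ∩ U).Nonempty, (F * w (A.card - 1) + 2 ^ K) :=
          Finset.sum_le_sum fun A _ => hnle _
      _ = F * ∑ A : Finset (Fin K) with (A ∩ U).Nonempty, w (A.card - 1)
          + (Finset.univ.filter fun A : Finset (Fin K) => (A ∩ U).Nonempty).card * 2 ^ K := by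
          rw [Finset.sum_add_distrib, ← Finset.mul_sum, Finset.sum_const, nsmul_eq_mul]
      _ ≤ F * R + 2 ^ K * 2 ^ K := by
          gcongr
          · exact hwR d U hU
          · have := Finset.card_filter_le (Finset.univ : Finset (Finset (Fin K)))
              (fun A => (A ∩ U).Nonempty)
            simp only [Finset.card_univ, Fintype.card_finset, Fintype.card_fin] at this
            exact_mod_cast this
      _ ≤ F * (R + ε) := by linarith

/-- For `F ≥ 1`, a negative rate would leave the encoder an empty alphabet. -/
theorem AvgAchievable.nonneg {K N : ℕ} (hN : 1 ≤ N) {M R : ℝ} (h : AvgAchievable K N M R) :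
    0 ≤ R := by
  refine le_of_forall_pos_le_add fun ε hε => ?_
  obtain ⟨F, ⟨Rd, ⟨s⟩, hle⟩, hF⟩ := ((h ε hε).and (eventually_ge_atTop 1)).exists
  refine le_trans (mul_nonneg (by positivity) (Finset.sum_nonneg fun d _ => ?_)) hle
  by_contra hneg
  have hlt : (2 : ℝ) ^ ((F : ℝ) * Rd d) < 1 :=
    Real.rpow_lt_one_of_one_lt_of_neg one_lt_two
      (mul_neg_of_pos_of_neg (by exact_mod_cast hF) (not_le.mp hneg))
  have h0 : ⌊(2 : ℝ) ^ ((F : ℝ) * Rd d)⌋₊ = 0 := Nat.floor_eq_zero.mpr hlt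
  have x := s.encode d fun _ => ⟨0, by positivity⟩
  rw [h0] at x
  exact x.elim0

/-! ### Bernoulli placements -/

/-- The probability that each receiver of a given `t`-subset of the `K` receivers, and no other
one, caches a given symbol when receivers cache independently with probability `q`. -/
noncomputable def bernoulliWeight (K : ℕ) (q : ℝ) (t : ℕ) : ℝ :=
  q ^ t * (1 - q) ^ (K - t)

theorem bernoulliWeight_nonneg {K : ℕ} {q : ℝ} (h0 : 0 ≤ q) (h1 : q ≤ 1) (t : ℕ) :
    0 ≤ bernoulliWeight K q t :=
  mul_nonneg (pow_nonneg h0 _) (pow_nonneg (sub_nonneg.mpr h1) _)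

theorem sum_bernoulliWeight_powerset {K : ℕ} (q : ℝ) (s : Finset (Fin K)) :
    ∑ S ∈ s.powerset, bernoulliWeight K q S.card = (1 - q) ^ (K - s.card) := by
  have h := Finset.sum_pow_mul_eq_add_pow q (1 - q) s
  have hs : s.card ≤ K := by simpa using s.card_le_univ
  rw [add_sub_cancel, one_pow] at h
  refine Eq.trans ?_ (one_mul ((1 - q) ^ (K - s.card)))
  refine Eq.trans ?_ (congrArg (· * (1 - q) ^ (K - s.card)) h)
  rw [Finset.sum_mul]
  refine Finset.sum_congr rfl fun S hS => ?_
  have hS := Finset.card_le_card (Finset.mem_powerset.mp hS)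
  rw [bernoulliWeight, mul_assoc, ← pow_add]
  congr 2
  omega

theorem sum_bernoulliWeight {K : ℕ} (q : ℝ) :
    ∑ S : Finset (Fin K), bernoulliWeight K q S.card = 1 := by
  have h := sum_bernoulliWeight_powerset q (Finset.univ : Finset (Fin K))
  simpa using h

theorem sum_bernoulliWeight_inter_nonempty {K : ℕ} (q : ℝ) (U : Finset (Fin K)) :
    ∑ S : Finset (Fin K) with (S ∩ U).Nonempty, bernoulliWeight K q S.card =
      1 - (1 - q) ^ U.card := by
  have h := Finset.sum_filter_add_sum_filter_not Finset.univ
    (fun S : Finset (Fin K) => (S ∩ U).Nonempty) (fun S => bernoulliWeight K q S.card)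
  rw [sum_bernoulliWeight] at h
  have hU : U.card ≤ K := by simpa using U.card_le_univ
  have hc : (Finset.univ.filter fun S : Finset (Fin K) => ¬ (S ∩ U).Nonempty) =
      Uᶜ.powerset := by
    ext S
    simp [Finset.not_nonempty_iff_eq_empty, ← Finset.disjoint_iff_inter_eq_empty,
      Finset.subset_compl_iff_disjoint_right]
  rw [hc, sum_bernoulliWeight_powerset, Finset.card_compl, Fintype.card_fin,
    Nat.sub_sub_self hU] at h
  linarith

theorem sum_bernoulliWeight_mem {K : ℕ} (q : ℝ) (k : Fin K) :
    ∑ S : Finset (Fin K) with k ∈ S, bernoulliWeight K q S.card = q := by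
  have h := sum_bernoulliWeight_inter_nonempty q {k}
  have hf : (Finset.univ.filter fun S : Finset (Fin K) => (S ∩ {k}).Nonempty) =
      Finset.univ.filter fun S => k ∈ S := by
    ext S
    simp [Finset.Nonempty]
  rw [hf] at h
  simpa using h

/-- The delivery rate of the Bernoulli placement with leader set `U`. -/
noncomputable def bernoulliRate {K : ℕ} (q : ℝ) (U : Finset (Fin K)) : ℝ :=
  ∑ A : Finset (Fin K) with (A ∩ U).Nonempty, bernoulliWeight K q (A.card - 1)

/-- Lowering the exponent by one multiplies a weight by `(1 - q) / q`; what remains is the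
probability that some leader caches the symbol. -/
theorem bernoulliRate_eq {K : ℕ} {q : ℝ} (hq : q ≠ 0) (U : Finset (Fin K)) :
    bernoulliRate q U = (1 - q) / q * (1 - (1 - q) ^ U.card) := by
  rw [← sum_bernoulliWeight_inter_nonempty, bernoulliRate, Finset.mul_sum]
  refine Finset.sum_congr rfl fun A hA => ?_
  have hpos : 0 < A.card := Finset.card_pos.mpr
    ((Finset.mem_filter.mp hA).2.mono Finset.inter_subset_left)
  have hK : A.card ≤ K := by simpa using A.card_le_univ
  obtain ⟨t, ht⟩ := Nat.exists_eq_succ_of_ne_zero hpos.ne'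
  rw [ht] at hK ⊢
  rw [bernoulliWeight, bernoulliWeight, Nat.succ_sub_one,
    show K - t = K - t.succ + 1 by omega, pow_succ (1 - q), Nat.succ_eq_add_one, pow_succ q]
  field_simp

theorem bernoulliRate_one {K : ℕ} (U : Finset (Fin K)) : bernoulliRate 1 U = 0 := by
  rw [bernoulliRate_eq one_ne_zero]
  simp

/-- Without caching, only the singleton groups of leaders carry weight. -/
theorem bernoulliRate_zero_le {K : ℕ} (U : Finset (Fin K)) : bernoulliRate 0 U ≤ U.card := by
  have h : ∀ A : Finset (Fin K), (A ∩ U).Nonempty →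
      bernoulliWeight K 0 (A.card - 1) = if A.card = 1 then 1 else 0 := by
    intro A hA
    have hpos : 0 < A.card := Finset.card_pos.mpr (hA.mono Finset.inter_subset_left)
    by_cases h1 : A.card = 1
    · simp [h1, bernoulliWeight]
    · rw [if_neg h1, bernoulliWeight, zero_pow (by omega), zero_mul]
  rw [bernoulliRate, Finset.sum_congr rfl fun A hA => h A (Finset.mem_filter.mp hA).2,
    Finset.sum_ite, Finset.sum_const_zero, add_zero, Finset.sum_const, nsmul_eq_mul, mul_one,
    Nat.cast_le]
  have hsub : ((Finset.univ.filter fun A : Finset (Fin K) => (A ∩ U).Nonempty).filter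
      fun A => A.card = 1) ⊆ U.image fun k => {k} := by
    intro A hA
    simp only [Finset.mem_filter, Finset.mem_univ, true_and] at hA
    obtain ⟨k, rfl⟩ := Finset.card_eq_one.mp hA.2
    obtain ⟨j, hj⟩ := hA.1
    obtain ⟨h1, h2⟩ := Finset.mem_inter.mp hj
    rw [Finset.mem_singleton] at h1
    exact Finset.mem_image.mpr ⟨k, h1 ▸ h2, rfl⟩
  exact (Finset.card_le_card hsub).trans Finset.card_image_le

theorem IsLeaderSet.card_le_min {K N : ℕ} {d : Demand K N} {U : Finset (Fin K)}
    (hU : IsLeaderSet d U) : U.card ≤ min K N := by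
  refine le_min (by simpa using U.card_le_univ) ?_
  have h := Finset.card_le_card_of_injOn (s := U) (t := Finset.univ) d
    (fun _ _ => Finset.mem_univ _) hU.injOn
  simpa using h

/-- Memory sharing between two Bernoulli placements. -/
theorem avgAchievable_convexCombination {K N : ℕ} (hN : 1 ≤ N) {a b q q' r r' M : ℝ}
    (ha : 0 ≤ a) (hb : 0 ≤ b) (hab : a + b = 1) (hq : q ∈ Icc (0 : ℝ) 1)
    (hq' : q' ∈ Icc (0 : ℝ) 1) (hM : N * (a * q + b * q') ≤ M)
    (hr : ∀ U : Finset (Fin K), U.card ≤ min K N → bernoulliRate q U ≤ r)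
    (hr' : ∀ U : Finset (Fin K), U.card ≤ min K N → bernoulliRate q' U ≤ r') :
    AvgAchievable K N M (a * r + b * r') := by
  refine avgAchievable_of_weights hN
    (w := fun t => a * bernoulliWeight K q t + b * bernoulliWeight K q' t) (fun t => ?_) ?_
    (fun k => ?_) (fun d U hU => ?_)
  · exact add_nonneg (mul_nonneg ha (bernoulliWeight_nonneg hq.1 hq.2 t))
      (mul_nonneg hb (bernoulliWeight_nonneg hq'.1 hq'.2 t))
  · rw [Finset.sum_add_distrib, ← Finset.mul_sum, ← Finset.mul_sum, sum_bernoulliWeight,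
      sum_bernoulliWeight, mul_one, mul_one, hab]
  · rwa [Finset.sum_add_distrib, ← Finset.mul_sum, ← Finset.mul_sum, sum_bernoulliWeight_mem,
      sum_bernoulliWeight_mem]
  · rw [Finset.sum_add_distrib, ← Finset.mul_sum, ← Finset.mul_sum]
    exact add_le_add (mul_le_mul_of_nonneg_left (hr U hU.card_le_min) ha)
      (mul_le_mul_of_nonneg_left (hr' U hU.card_le_min) hb)

/-! ### Bounds on `eta` -/

theorem exp_neg_two_mul_le_rpow {u v : ℝ} (hu : 0 < u) (hv : 0 < v) (hv' : v ≤ 1 / 2) :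
    Real.exp (-(2 * u)) ≤ (1 - v) ^ (u / v) := by
  have h1 : 0 < 1 - v := by linarith
  rw [Real.rpow_def_of_pos h1, Real.exp_le_exp]
  have hlog := Real.one_sub_inv_le_log_of_pos h1
  have hinv : (1 - v)⁻¹ ≤ 1 + 2 * v := by
    rw [inv_le_iff_one_le_mul₀ h1]
    nlinarith
  calc -(2 * u) = (-(2 * v)) * (u / v) := by field_simp
    _ ≤ Real.log (1 - v) * (u / v) :=
      mul_le_mul_of_nonneg_right (by linarith) (div_pos hu hv).le

theorem rpow_le_exp_neg {u v : ℝ} (hu : 0 < u) (hv : 0 < v) (hv' : v ≤ 1 / 2) :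
    (1 - v) ^ (u / v) ≤ Real.exp (-u) := by
  have h1 : 0 < 1 - v := by linarith
  rw [Real.rpow_def_of_pos h1, Real.exp_le_exp]
  have hlog := Real.log_le_sub_one_of_pos h1
  calc Real.log (1 - v) * (u / v) ≤ (-v) * (u / v) :=
      mul_le_mul_of_nonneg_right (by linarith) (div_pos hu hv).le
    _ = -u := by field_simp

theorem quarter_le_one_sub_of_le_exp_neg {u b : ℝ} (hu : 0 < u) (hu' : u ≤ 1)
    (hb : b ≤ Real.exp (-u)) : u / 4 ≤ 1 - (1 + u / 2) * b := by
  have h1 : Real.exp (-u) ≤ (1 + u)⁻¹ := by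
    rw [Real.exp_neg]
    exact inv_anti₀ (by linarith) (by linarith [Real.add_one_le_exp u])
  have h2 : (1 + u / 2) * b ≤ (1 + u / 2) * (1 + u)⁻¹ :=
    mul_le_mul_of_nonneg_left (hb.trans h1) (by linarith)
  have h3 : (1 + u / 2) * (1 + u)⁻¹ ≤ 1 - u / 4 := by
    rw [← div_eq_mul_inv, div_le_iff₀ (by linarith)]
    nlinarith
  linarith

/-- With `b = (1 - v) ^ (u / v)`, the denominator is at least `u / 36` and the first factor of the
numerator at most `2 * u`, whence `72`. -/
theorem eta_le {u v : ℝ} (hu : u ∈ Ioc (0 : ℝ) 1) (hv : v ∈ Ioc (0 : ℝ) (1 / 2)) :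
    eta u v ≤ 72 := by
  obtain ⟨hu, hu'⟩ := hu
  obtain ⟨hv, hv'⟩ := hv
  have hlo := exp_neg_two_mul_le_rpow hu hv hv'
  have hhi := rpow_le_exp_neg hu hv hv'
  unfold eta
  set b := (1 - v) ^ (u / v)
  have hb2 : 1 - 2 * u ≤ b := by linarith [Real.add_one_le_exp (-(2 * u))]
  -- Since `u ≤ 1`, `b ≥ exp (-2)`, and `exp 2 ≤ 9`.
  have hb9 : 1 / 9 ≤ b := by
    refine le_trans ?_ hlo
    refine le_trans ?_ (Real.exp_le_exp.mpr (show (-2 : ℝ) ≤ -(2 * u) by linarith))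
    rw [Real.exp_neg, one_div]
    refine inv_anti₀ (Real.exp_pos _) ?_
    have h := Real.exp_one_lt_d9
    rw [show (2 : ℝ) = 1 + 1 by norm_num, Real.exp_add]
    nlinarith [Real.exp_pos 1]
  have hb1 : b ≤ 1 := hhi.trans (Real.exp_le_one_iff.mpr (by linarith))
  have hD := quarter_le_one_sub_of_le_exp_neg hu hu' hhi
  have hden : u / 36 ≤ b * (1 - (1 + u / 2) * b) :=
    calc u / 36 = 1 / 9 * (u / 4) := by ring
      _ ≤ _ := mul_le_mul hb9 hD (by linarith) (by linarith)
  have hq : v / (u + v) * b ≤ 1 :=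
    mul_le_one₀ ((div_le_one (by linarith)).mpr (by linarith)) (by linarith) hb1
  have hp : 0 ≤ (1 - v / (u + v) * b) ^ (1 / v) := Real.rpow_nonneg (by linarith) _
  have h0 : 0 ≤ u + v - v * b := by nlinarith
  have h2 : u + v - v * b ≤ 2 * u := by nlinarith
  rw [div_le_iff₀ (by linarith)]
  calc (u + v - v * b) * (1 - (1 - v / (u + v) * b) ^ (1 / v))
      ≤ (u + v - v * b) * 1 := mul_le_mul_of_nonneg_left (by linarith) h0
    _ ≤ 72 * (b * (1 - (1 + u / 2) * b)) := by linarith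

theorem bddAbove_etaValues : BddAbove etaValues := by
  refine ⟨72, ?_⟩
  rintro y ⟨u, hu, v, hv, rfl⟩
  exact eta_le hu hv

theorem eta_le_sSup {u v : ℝ} (hu : u ∈ Ioc (0 : ℝ) 1) (hv : v ∈ Ioc (0 : ℝ) (1 / 2)) :
    eta u v ≤ sSup etaValues :=
  le_csSup bddAbove_etaValues ⟨u, hu, v, hv, rfl⟩

/-- The factor `2` is what the uncached node `q = 0` requires. -/
theorem two_le_sSup_etaValues : 2 ≤ sSup etaValues := by
  refine le_trans ?_ (eta_le_sSup (u := 1 / 4) (v := 1 / 4) (by norm_num) (by norm_num))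
  rw [eta, show (1 : ℝ) / (1 / 4) = (4 : ℕ) by norm_num, Real.rpow_natCast]
  norm_num

/-! ### The lower bound and its corners -/

/-- The `ℓ`-th affine piece of the lower bound. -/
noncomputable def lowLine (N ℓ : ℕ) (M : ℝ) : ℝ :=
  (1 - (1 - 1 / (N : ℝ)) ^ ℓ) * (N : ℝ) - ((ℓ : ℝ) * ((ℓ : ℝ) + 1)) / (2 * (N : ℝ)) * M

theorem lowLine_le_avgLow {K N ℓ : ℕ} (hK : 1 ≤ K) (h1 : 1 ≤ ℓ) (h2 : ℓ ≤ K) (M : ℝ) :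
    lowLine N ℓ M ≤ avgLow K N hK M :=
  le_max_of_le_right (Finset.le_sup' (f := fun ℓ : ℕ => lowLine N ℓ M)
    (Finset.mem_Icc.mpr ⟨h1, h2⟩))

theorem avgLow_pos {K N : ℕ} (hK : 1 ≤ K) (hN : 1 ≤ N) {M : ℝ} (hM : M < N) :
    0 < avgLow K N hK M := by
  refine lt_of_lt_of_le ?_ (lowLine_le_avgLow hK le_rfl hK M)
  have hN' : (0 : ℝ) < N := by exact_mod_cast hN
  have : lowLine N 1 M = (N - M) / N := by
    rw [lowLine]
    push_cast
    field_simp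
    ring
  rw [this]
  exact div_pos (by linarith) hN'

theorem lowLine_convexCombination (N ℓ : ℕ) {a b : ℝ} (hab : a + b = 1) (x y : ℝ) :
    lowLine N ℓ (a * x + b * y) = a * lowLine N ℓ x + b * lowLine N ℓ y := by
  obtain rfl : a = 1 - b := by linarith
  simp only [lowLine]
  ring

/-- The cached fraction at which the pieces `ℓ` and `ℓ + 1` of the lower bound meet. -/
noncomputable def corner (N ℓ : ℕ) : ℝ :=
  (1 - 1 / (N : ℝ)) ^ ℓ / (ℓ + 1)

theorem lowLine_corner {N : ℕ} (hN : 1 ≤ N) (ℓ : ℕ) :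
    lowLine N ℓ (N * corner N ℓ) =
      N * (1 - (1 + (ℓ / N : ℝ) / 2) * (1 - 1 / (N : ℝ)) ^ ℓ) := by
  have hN' : (0 : ℝ) < N := by exact_mod_cast hN
  rw [lowLine, corner]
  have : (ℓ : ℝ) + 1 ≠ 0 := by positivity
  generalize (1 - 1 / (N : ℝ)) ^ ℓ = b
  field_simp
  ring

theorem lowLine_succ_corner {N : ℕ} (hN : 1 ≤ N) (ℓ : ℕ) :
    lowLine N (ℓ + 1) (N * corner N ℓ) = lowLine N ℓ (N * corner N ℓ) := by
  have hN' : (0 : ℝ) < N := by exact_mod_cast hN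
  rw [lowLine, lowLine, corner, pow_succ]
  have : (ℓ : ℝ) + 1 ≠ 0 := by positivity
  generalize hb : (1 - 1 / (N : ℝ)) ^ ℓ = b
  push_cast
  field_simp
  ring

theorem corner_mem {N : ℕ} (hN : 1 ≤ N) (ℓ : ℕ) : corner N ℓ ∈ Icc (0 : ℝ) 1 := by
  have hN' : (1 : ℝ) ≤ N := by exact_mod_cast hN
  have h0 : 0 ≤ 1 - 1 / (N : ℝ) := by
    rw [sub_nonneg, div_le_one (by linarith)]; exact hN'
  have h1 : 1 - 1 / (N : ℝ) ≤ 1 := by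
    have : 0 ≤ 1 / (N : ℝ) := by positivity
    linarith
  refine ⟨div_nonneg (pow_nonneg h0 _) (by positivity), ?_⟩
  rw [corner, div_le_one (by positivity)]
  exact (pow_le_one₀ h0 h1).trans (by linarith [(Nat.cast_nonneg ℓ : (0 : ℝ) ≤ ℓ)])

/-- For `u = ℓ / N` and `v = 1 / N`, `v / (u + v) * (1 - v) ^ (u / v)` is the corner itself, so `eta
u v` is the ratio of the `N`-leader rate to the line. The bounds on `ℓ` and `N` place `(u, v)` in
the domain. -/
theorem bernoulliRate_corner_le {K N ℓ : ℕ} (hℓ : 1 ≤ ℓ) (hN : 2 ≤ N) (hℓN : ℓ ≤ N)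
    (U : Finset (Fin K)) (hU : U.card ≤ N) :
    bernoulliRate (corner N ℓ) U ≤ sSup etaValues * lowLine N ℓ (N * corner N ℓ) := by
  have hN' : (2 : ℝ) ≤ N := by exact_mod_cast hN
  have hN0 : (0 : ℝ) < N := by linarith
  have hℓ' : (1 : ℝ) ≤ ℓ := by exact_mod_cast hℓ
  have hu : (ℓ / N : ℝ) ∈ Ioc (0 : ℝ) 1 :=
    ⟨by positivity, (div_le_one hN0).mpr (by exact_mod_cast hℓN)⟩
  have hv : (1 / N : ℝ) ∈ Ioc (0 : ℝ) (1 / 2) :=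
    ⟨by positivity, one_div_le_one_div_of_le (by norm_num) hN'⟩
  have hpow : (1 - 1 / (N : ℝ)) ^ ((ℓ / N : ℝ) / (1 / N)) = (1 - 1 / (N : ℝ)) ^ ℓ := by
    rw [show (ℓ / N : ℝ) / (1 / N) = (ℓ : ℝ) by field_simp, Real.rpow_natCast]
  have hpos : 0 < 1 - (1 + (ℓ / N : ℝ) / 2) * (1 - 1 / (N : ℝ)) ^ ℓ := by
    have := quarter_le_one_sub_of_le_exp_neg hu.1 hu.2 (rpow_le_exp_neg hu.1 hv.1 hv.2)
    rw [hpow] at this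
    linarith [hu.1]
  have hqmem := corner_mem (one_le_two.trans hN) ℓ
  have hb : 0 < (1 - 1 / (N : ℝ)) ^ ℓ := pow_pos (by linarith [hv.2]) _
  have hq : 0 < corner N ℓ := div_pos hb (by positivity)
  have heta : eta (ℓ / N) (1 / N) * lowLine N ℓ (N * corner N ℓ) =
      (1 - corner N ℓ) / corner N ℓ * (1 - (1 - corner N ℓ) ^ N) := by
    rw [lowLine_corner (one_le_two.trans hN), eta, hpow, one_div_one_div, Real.rpow_natCast,
      show (1 / N : ℝ) / (ℓ / N + 1 / N) * (1 - 1 / (N : ℝ)) ^ ℓ = corner N ℓ by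
        rw [corner]; field_simp]
    generalize hP : (1 - corner N ℓ) ^ N = P
    rw [corner]
    generalize (1 - 1 / (N : ℝ)) ^ ℓ = b at hb hpos
    generalize hD : 1 - (1 + (ℓ / N : ℝ) / 2) * b = D at hpos
    have hℓ1 : (ℓ : ℝ) + 1 ≠ 0 := by positivity
    field_simp
  calc bernoulliRate (corner N ℓ) U
      = (1 - corner N ℓ) / corner N ℓ * (1 - (1 - corner N ℓ) ^ U.card) :=
        bernoulliRate_eq hq.ne' U
    _ ≤ (1 - corner N ℓ) / corner N ℓ * (1 - (1 - corner N ℓ) ^ N) := by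
        refine mul_le_mul_of_nonneg_left (sub_le_sub_left ?_ _)
          (div_nonneg (by linarith [hqmem.2]) hq.le)
        exact pow_le_pow_of_le_one (by linarith [hqmem.2]) (by linarith) hU
    _ = eta (ℓ / N) (1 / N) * lowLine N ℓ (N * corner N ℓ) := heta.symm
    _ ≤ sSup etaValues * lowLine N ℓ (N * corner N ℓ) := by
        refine mul_le_mul_of_nonneg_right (eta_le_sSup hu hv) ?_
        rw [lowLine_corner (one_le_two.trans hN)]
        exact mul_nonneg hN0.le hpos.le

/-- Bernoulli's inequality and `(1 - v) * (1 + v) ≤ 1` give `(1 - v) ^ ℓ ≤ 1 / (1 + ℓ * v) ≤ 1 - ℓ *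
v / 2` for `v = 1 / N`, as `ℓ * v ≤ 1`. -/
theorem natCast_le_two_mul_lowLine_zero {N ℓ : ℕ} (hN : 1 ≤ N) (hℓ : ℓ ≤ N) :
    (ℓ : ℝ) ≤ 2 * lowLine N ℓ 0 := by
  have hN' : (1 : ℝ) ≤ N := by exact_mod_cast hN
  have hN0 : (0 : ℝ) < N := by linarith
  set v : ℝ := 1 / N with hv
  have hv0 : 0 < v := by positivity
  have hv1 : v ≤ 1 := (div_le_one hN0).mpr hN'
  have hx : ℓ * v ≤ 1 := by
    rw [hv, mul_one_div, div_le_one hN0]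
    exact_mod_cast hℓ
  have hx0 : 0 ≤ ℓ * v := by positivity
  have hbern := one_add_mul_le_pow (show (-2 : ℝ) ≤ v by linarith) ℓ
  have hprod : (1 - v) ^ ℓ * (1 + v) ^ ℓ ≤ 1 := by
    rw [← mul_pow]
    exact pow_le_one₀ (mul_nonneg (by linarith) (by linarith)) (by nlinarith)
  have hb0 : 0 ≤ (1 - v) ^ ℓ := pow_nonneg (by linarith) _
  have hle : (1 - v) ^ ℓ ≤ 1 - ℓ * v / 2 := by
    have h1 : (1 - v) ^ ℓ * (1 + ℓ * v) ≤ 1 :=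
      (mul_le_mul_of_nonneg_left hbern hb0).trans hprod
    nlinarith
  rw [lowLine, ← hv, mul_zero, sub_zero]
  have hNv : v * N = 1 := by rw [hv]; field_simp
  calc (ℓ : ℝ) = 2 * ((ℓ * v / 2) * N) := by linear_combination (-(ℓ : ℝ)) * hNv
    _ ≤ 2 * ((1 - (1 - v) ^ ℓ) * N) := by gcongr; linarith

/-! ### Memory sharing between consecutive nodes -/

/-- The caching probabilities between which memory is shared. -/
noncomputable def node (N L ℓ : ℕ) : ℝ :=
  if ℓ = 0 then 1 else if ℓ = L then 0 else corner N ℓ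

theorem node_mem {N : ℕ} (hN : 1 ≤ N) (L ℓ : ℕ) : node N L ℓ ∈ Icc (0 : ℝ) 1 := by
  unfold node
  split_ifs
  · simp
  · simp
  · exact corner_mem hN ℓ

theorem bernoulliRate_node_le {K N ℓ : ℕ} (hN : 1 ≤ N) (hℓ : 1 ≤ ℓ) (hℓL : ℓ ≤ min K N)
    (U : Finset (Fin K)) (hU : U.card ≤ min K N) :
    bernoulliRate (node N (min K N) ℓ) U ≤
      sSup etaValues * lowLine N ℓ (N * node N (min K N) ℓ) := by
  rw [node, if_neg (by omega)]
  split_ifs with h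
  · have h2 := natCast_le_two_mul_lowLine_zero hN (h.le.trans (min_le_right K N))
    have hcard : (U.card : ℝ) ≤ ℓ := by exact_mod_cast (h ▸ hU)
    rw [mul_zero]
    have h3 : 0 ≤ lowLine N ℓ 0 := by linarith [(Nat.cast_nonneg ℓ : (0 : ℝ) ≤ ℓ)]
    have := mul_le_mul_of_nonneg_right two_le_sSup_etaValues h3
    linarith [bernoulliRate_zero_le U]
  -- A corner strictly between the end nodes forces `N ≥ 2`, hence `v ≤ 1 / 2`.
  · exact bernoulliRate_corner_le hℓ (by omega) (by omega) U (by omega)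

theorem bernoulliRate_node_le_succ {K N ℓ : ℕ} (hN : 1 ≤ N) (hℓL : ℓ < min K N)
    (U : Finset (Fin K)) (hU : U.card ≤ min K N) :
    bernoulliRate (node N (min K N) ℓ) U ≤
      sSup etaValues * lowLine N (ℓ + 1) (N * node N (min K N) ℓ) := by
  rcases Nat.eq_zero_or_pos ℓ with rfl | hℓ
  · have hN' : (0 : ℝ) < N := by exact_mod_cast hN
    have : lowLine N (0 + 1) (N * 1) = 0 := by
      rw [lowLine]
      push_cast
      field_simp
      ring
    rw [node, if_pos rfl, this, bernoulliRate_one, mul_zero]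
  · have h := bernoulliRate_node_le hN hℓ hℓL.le U hU
    have hnode : node N (min K N) ℓ = corner N ℓ := by
      rw [node, if_neg hℓ.ne', if_neg hℓL.ne]
    rw [hnode] at h ⊢
    rwa [lowLine_succ_corner hN]

theorem exists_avgAchievable_le {K N : ℕ} (hK : 1 ≤ K) (hN : 1 ≤ N) {M : ℝ} (hM : 0 ≤ M)
    (hMN : M < N) :
    ∃ R, AvgAchievable K N M R ∧ R ≤ sSup etaValues * avgLow K N hK M := by
  have hN' : (0 : ℝ) < N := by exact_mod_cast hN
  set L := min K N with hL
  have hL1 : 1 ≤ L := le_min hK hN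
  have hex : ∃ ℓ, N * node N L ℓ ≤ M :=
    ⟨L, by rw [node, if_neg (by omega), if_pos rfl, mul_zero]; exact hM⟩
  classical
  obtain ⟨ℓ, hℓ⟩ : ∃ ℓ, Nat.find hex = ℓ + 1 := by
    refine Nat.exists_eq_succ_of_ne_zero fun h0 => ?_
    have := Nat.find_spec hex
    rw [h0, node, if_pos rfl, mul_one] at this
    linarith
  have hlo : N * node N L (ℓ + 1) ≤ M := hℓ ▸ Nat.find_spec hex
  -- Taking the first node at or below `M` puts its predecessor above `M`, so no monotonicity of the
  -- nodes is needed.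
  have hhi : M < N * node N L ℓ := not_le.mp (Nat.find_min hex (by omega))
  have hℓL : ℓ + 1 ≤ L := hℓ ▸ Nat.find_min' hex
    (by rw [node, if_neg (by omega), if_pos rfl, mul_zero]; exact hM)
  set x := N * node N L (ℓ + 1) with hx
  set y := N * node N L ℓ with hy
  have hxy : 0 < y - x := by linarith
  have hab : (y - M) / (y - x) + (M - x) / (y - x) = 1 := by
    field_simp
    ring
  have hcomb : (y - M) / (y - x) * x + (M - x) / (y - x) * y = M := by
    field_simp
    ring
  have ha : 0 ≤ (y - M) / (y - x) := div_nonneg (by linarith) hxy.le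
  have hb : 0 ≤ (M - x) / (y - x) := div_nonneg (by linarith) hxy.le
  refine ⟨_, avgAchievable_convexCombination hN ha hb hab (node_mem hN L (ℓ + 1))
    (node_mem hN L ℓ) ?_ (fun U hU => bernoulliRate_node_le hN (by omega) hℓL U hU)
    (fun U hU => bernoulliRate_node_le_succ hN hℓL U hU), ?_⟩
  · rw [mul_add, mul_left_comm, mul_left_comm (N : ℝ), ← hx, ← hy, hcomb]
  -- Both endpoint bounds use the same line `ℓ + 1`, so they combine into its value at `M`.
  · rw [← hL, ← hx, ← hy, mul_left_comm, mul_left_comm _ (sSup etaValues), ← mul_add,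
      ← lowLine_convexCombination N (ℓ + 1) hab, hcomb]
    refine mul_le_mul_of_nonneg_left ?_ (by linarith [two_le_sSup_etaValues])
    exact lowLine_le_avgLow hK (by omega) (hℓL.trans (min_le_left K N)) M

end CodedCaching

theorem theorem4 :
    BddAbove CodedCaching.etaValues ∧
      ∀ (K N : ℕ) (hK : 1 ≤ K) (_hN : 1 ≤ N) (M : ℝ), 0 ≤ M → M < (N : ℝ) →
        IsGLB {R : ℝ | CodedCaching.AvgAchievable K N M R} (CodedCaching.avgTradeoff K N M) ∧
        0 < CodedCaching.avgLow K N hK M ∧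
        CodedCaching.avgTradeoff K N M / CodedCaching.avgLow K N hK M ≤
          sSup CodedCaching.etaValues := by
  refine ⟨CodedCaching.bddAbove_etaValues, fun K N hK hN M hM hMN => ?_⟩
  obtain ⟨R, hR, hle⟩ := CodedCaching.exists_avgAchievable_le hK hN hM hMN
  have hbdd : BddBelow {R : ℝ | CodedCaching.AvgAchievable K N M R} :=
    ⟨0, fun _ h => CodedCaching.AvgAchievable.nonneg hN h⟩
  have hpos := CodedCaching.avgLow_pos hK hN hMN
  refine ⟨Real.isGLB_sInf ⟨R, hR⟩ hbdd, hpos, ?_⟩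
  rw [div_le_iff₀ hpos]
  exact (csInf_le hbdd hR).trans hle
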